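/- Let $I=[0,1]$ with the Euclidean metric $\varrho$, let $f:I\to I$ be continuous and $x\in I$, and let $\omega_f(x)$ be the set of limit points of the trajectory $(f^n(x))_{n\ge 0}$. A nonempty set $Y\subseteq I$ is *$p$-periodic* ($p\ge 1$) if $f^i(Y)$, $0\le i<p$, are pairwise disjoint and $f^p(Y)=Y$; it is *periodic* if it is $p$-periodic for some $p\ge1$. Two distinct points $y,z\in I$ are *non-separable* if there are no disjoint periodic intervals $J_y\ni y$ and $J_z\ni z$. Assume that $\omega_f(x)$ is ($2$-adically) solenoidal: there are non-degenerate closed intervals $J_1\supseteq J_2\supseteq\cdots$ in $I$ such that every $J_t$ is $2^t$-periodic and $$\omega_f(x)\subseteq\bigcap_{t\ge 1}\ \bigcup_{i=0}^{2^t-1} f^i(J_t).$$ Assume moreover that $\omega_f(x)$ does not contain two non-separable points. For $\varepsilon>0$, $n\ge 1$ and $m\in\{1,2,\dots,\infty\}$ put $$\varrho_m(y,z)=\sup_{0\le i<m}\varrho(f^i(y),f^i(z)),\qquad C_m(x,n,\varepsilon)=\frac1{n^2}\operatorname{card}\{(i,j): 0\le i,j<n,\ \varrho_m(f^i(x),f^j(x))\le\varepsilon\},$$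 and let $$\overline{\mathrm{DET}}_\infty(x,\varepsilon)=\limsup_{n\to\infty}\frac{C_\infty(x,n,\varepsilon)}{C_1(x,n,\varepsilon)}$$ be the upper asymptotic recurrence determinism. Then $$\liminf_{\varepsilon\to 0^+}\ \overline{\mathrm{DET}}_\infty(x,\varepsilon)\le\frac45.$$ -/

import Mathlib

open Filter Topology
open scoped unitInterval

noncomputable section

/-- The nonempty set `Y` is `p`-periodic for `f`, `p ≥ 1`: the images `f^i(Y)`, `0 ≤ i < p`, are
pairwise disjoint and `f^p(Y) = Y`. -/
structure IsPeriodicSet {X : Type*} (f : X → X) (p : ℕ) (Y : Set X) : Prop where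
  nonempty : Y.Nonempty
  period_pos : 0 < p
  disjoint : (Set.Iio p).PairwiseDisjoint (fun i : ℕ => f^[i] '' Y)
  image_eq : f^[p] '' Y = Y

/-- A periodic interval of `f : I → I`: an interval (not necessarily closed or non-degenerate)
that is a `p`-periodic set for some `p ≥ 1`. -/
def IsPeriodicInterval (f : I → I) (J : Set I) : Prop :=
  J.OrdConnected ∧ ∃ p : ℕ, IsPeriodicSet f p J

/-- `y` and `z` are separable: they lie in disjoint periodic intervals. -/
def Separable (f : I → I) (y z : I) : Prop :=
  ∃ Jy Jz : Set I, IsPeriodicInterval f Jy ∧ IsPeriodicInterval f Jz ∧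
    Disjoint Jy Jz ∧ y ∈ Jy ∧ z ∈ Jz

/-- `y` and `z` are non-separable: they are distinct and not separable. -/
def NonSeparable (f : I → I) (y z : I) : Prop :=
  y ≠ z ∧ ¬ Separable f y z

/-- The `ω`-limit set of the point `x`, i.e. the set of limit points of `(f^n(x))_n`. -/
def omegaLimitSet (f : I → I) (x : I) : Set I :=
  omegaLimit atTop (fun (n : ℕ) (y : I) => f^[n] y) {x}

/-- `S` is solenoidal with the periods `2 ≤ p 0 < p 1 < ⋯`: there are non-degenerate closed
intervals `J 0 ⊇ J 1 ⊇ ⋯` such that `J t` is `p t`-periodic and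
`S ⊆ ⋂ t, ⋃ i < p t, f^i(J t)`. -/
def IsSolenoidalWith (f : I → I) (p : ℕ → ℕ) (S : Set I) : Prop :=
  2 ≤ p 0 ∧ StrictMono p ∧
    ∃ J : ℕ → Set I,
      (∀ t, ∃ a b : I, a < b ∧ J t = Set.Icc a b) ∧
      Antitone J ∧
      (∀ t, IsPeriodicSet f (p t) (J t)) ∧
      S ⊆ ⋂ t, ⋃ i ∈ Set.Iio (p t), f^[i] '' J t

/-- `S` is `2`-adically solenoidal: solenoidal with the periods `2, 4, 8, …`. -/
def IsDyadicSolenoidal (f : I → I) (S : Set I) : Prop :=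
  IsSolenoidalWith f (fun t => 2 ^ (t + 1)) S

/-- Bowen's metric `ϱ_m`, `m ∈ {1, 2, …, ∞}`: the supremum of `ϱ(f^i(y), f^i(z))` over
`0 ≤ i < m`. -/
def bowenDist (f : I → I) (m : ℕ∞) (y z : I) : ℝ :=
  ⨆ i : {i : ℕ // (i : ℕ∞) < m}, dist (f^[i] y) (f^[i] z)

/-- The correlation sum `C_m(x, n, ε)`, `m ∈ {1, 2, …, ∞}`. -/
def corrSum (f : I → I) (m : ℕ∞) (x : I) (n : ℕ) (ε : ℝ) : ℝ :=
  (((Finset.range n ×ˢ Finset.range n).filter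
    (fun ij => bowenDist f m (f^[ij.1] x) (f^[ij.2] x) ≤ ε)).card : ℝ) / (n : ℝ) ^ 2

/-- The recurrence `m`-determinism `C_m(x, n, ε) / C_1(x, n, ε)`. -/
def rdet (f : I → I) (m : ℕ∞) (x : I) (n : ℕ) (ε : ℝ) : ℝ :=
  corrSum f m x n ε / corrSum f 1 x n ε

/-- The upper asymptotic recurrence `m`-determinism, the upper limit of the recurrence
`m`-determinism (a sequence in `[0, 1]`) as `n → ∞`. -/
def upperRdet (f : I → I) (m : ℕ∞) (x : I) (ε : ℝ) : ℝ :=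
  limsup (fun n : ℕ => rdet f m x n ε) atTop

end

/-! Put `h = 2 ^ (L + 1)`. The intervals of levels `L`, `L + 1`, `L + 2` of the tower have periods
`h`, `2h`, `4h`: an interval of level `L` splits into two halves and four quarters. Replace each by
the hull of its limit points. Let `β` be the largest length among the hulls of halves and the hulls
spanned by the two quarters that face each other across the gap between the halves. For `ε` slightly
above `β`: - If the orbits of `f^i x` and `f^j x` stay `ε`-close forever, then `i ≡ j` modulo `2h`.
Otherwise the shift by `j - i` moves some endpoint farther than the length that defines `β`
(`IsDyadicBounds.exists_threshold`). Hence `C_∞` is asymptotically at most `1/(2h)`. - Two late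
iterates are `ε`-close whenever they visit the same half or a pair of facing quarters. This gives
`8h + 2h` of the `16h²` pairs of residues modulo `4h`, so `C_1` is asymptotically at least `5/(8h)`.
The ratio is `4/5`. Since `β` is at most the length of some hull of level `L`, it tends to `0` with
`L`: points that share an interval at every level are non-separable, and compactness makes the
smallness uniform (`IsDyadicTower.exists_forall_dist_lt`). -/

/-! ### Periodic towers, limit points and order-convex sets -/

/-- A doubling tower of cycles of closed intervals: the level `L` consists of `2 ^ (L + 1)` disjoint
intervals `K L r`, indexed by `r` modulo `2 ^ (L + 1)`, which `f` permutes cyclically. -/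
structure IsDyadicTower (f : I → I) (K : ℕ → ℕ → Set I) : Prop where
  isClosed : ∀ L r, IsClosed (K L r)
  ordConnected : ∀ L r, (K L r).OrdConnected
  image : ∀ L r i, f^[i] '' K L r = K L (r + i)
  congr : ∀ L r s, r ≡ s [MOD 2 ^ (L + 1)] → K L r = K L s
  disjoint : ∀ L r s, ¬ r ≡ s [MOD 2 ^ (L + 1)] → Disjoint (K L r) (K L s)
  antitone : ∀ L r, K (L + 1) r ⊆ K L r

theorem IsPeriodicSet.image_iterate_mul {X : Type*} {f : X → X} {p : ℕ} {Y : Set X}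
    (h : IsPeriodicSet f p Y) (k : ℕ) : f^[p * k] '' Y = Y := by
  induction k with
  | zero => simp
  | succ k ih => rw [Nat.mul_succ, Function.iterate_add, Set.image_comp, h.image_eq, ih]

theorem IsPeriodicSet.image_iterate_mod {X : Type*} {f : X → X} {p : ℕ} {Y : Set X}
    (h : IsPeriodicSet f p Y) (i : ℕ) : f^[i] '' Y = f^[i % p] '' Y := by
  conv_lhs => rw [← Nat.mod_add_div i p]
  rw [Function.iterate_add, Set.image_comp, h.image_iterate_mul]

theorem IsPeriodicSet.disjoint_of_mod_ne {X : Type*} {f : X → X} {p : ℕ} {Y : Set X}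
    (h : IsPeriodicSet f p Y) {i j : ℕ} (hij : i % p ≠ j % p) :
    Disjoint (f^[i] '' Y) (f^[j] '' Y) := by
  rw [h.image_iterate_mod i, h.image_iterate_mod j]
  exact h.disjoint (Nat.mod_lt _ h.period_pos) (Nat.mod_lt _ h.period_pos) hij

theorem IsDyadicSolenoidal.exists_tower {f : I → I} (hf : Continuous f) {S : Set I}
    (hS : IsDyadicSolenoidal f S) :
    ∃ K, IsDyadicTower f K ∧ ∀ L, ∀ y ∈ S, ∃ r, y ∈ K L r := by
  obtain ⟨-, -, J, hJ, hanti, hper, hsub⟩ := hS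
  refine ⟨fun L r => f^[r] '' J L, ⟨?_, ?_, ?_, ?_, ?_, ?_⟩, ?_⟩
  · intro L r
    obtain ⟨a, b, -, h⟩ := hJ L
    rw [h]
    exact (isCompact_Icc.image (hf.iterate r)).isClosed
  · intro L r
    obtain ⟨a, b, -, h⟩ := hJ L
    rw [h]
    exact (isPreconnected_Icc.image _ (hf.iterate r).continuousOn).ordConnected
  · intro L r i
    rw [← Set.image_comp, ← Function.iterate_add, add_comm i r]
  · intro L r s h
    rw [(hper L).image_iterate_mod r, (hper L).image_iterate_mod s]
    exact congrArg (fun i => f^[i] '' J L) h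
  · intro L r s h
    exact (hper L).disjoint_of_mod_ne h
  · intro L r
    exact Set.image_mono (hanti (Nat.le_succ L))
  · intro L y hy
    have := Set.mem_iInter.1 (hsub hy) L
    simp only [Set.mem_iUnion] at this
    obtain ⟨i, -, hi⟩ := this
    exact ⟨i, hi⟩

theorem exists_add_modEq_two_pow (p r s : ℕ) : ∃ i, r + i ≡ s [MOD 2 ^ p] := by
  obtain ⟨m, hm⟩ : ∃ m, 2 ^ p = m + 1 :=
    ⟨2 ^ p - 1, (Nat.sub_add_cancel Nat.one_le_two_pow).symm⟩
  refine ⟨m * r + s, ?_⟩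
  have : r + (m * r + s) = 2 ^ p * r + s := by rw [hm]; ring
  rw [this, Nat.ModEq, Nat.mul_add_mod]

theorem mem_omegaLimitSet_iff {f : I → I} {x y : I} :
    y ∈ omegaLimitSet f x ↔
      ∃ U : Ultrafilter ℕ, (U : Filter ℕ) ≤ atTop ∧ Tendsto (fun n => f^[n] x) U (𝓝 y) := by
  rw [omegaLimitSet, mem_omegaLimit_singleton_iff_mapClusterPt, mapClusterPt_iff_ultrafilter]

theorem mem_omegaLimitSet_of_tendsto {f : I → I} {x y : I} {U : Ultrafilter ℕ} {g : ℕ → ℕ}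
    (hg : Tendsto g U atTop) (h : Tendsto (fun n => f^[g n] x) U (𝓝 y)) :
    y ∈ omegaLimitSet f x :=
  mem_omegaLimitSet_iff.2 ⟨U.map g, hg, h⟩

theorem isClosed_omegaLimitSet (f : I → I) (x : I) : IsClosed (omegaLimitSet f x) :=
  isClosed_omegaLimit _ _ _

theorem exists_tendsto_of_ultrafilter (U : Ultrafilter ℕ) (u : ℕ → I) :
    ∃ y, Tendsto u U (𝓝 y) := by
  obtain ⟨y, -, hy⟩ := isCompact_univ.ultrafilter_le_nhds (U.map u) (by simp)
  exact ⟨y, hy⟩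

theorem omegaLimitSet_nonempty (f : I → I) (x : I) : (omegaLimitSet f x).Nonempty := by
  obtain ⟨y, hy⟩ := exists_tendsto_of_ultrafilter (Ultrafilter.of atTop) (fun n => f^[n] x)
  exact ⟨y, mem_omegaLimitSet_iff.2 ⟨_, Ultrafilter.of_le _, hy⟩⟩

theorem iterate_mem_omegaLimitSet {f : I → I} (hf : Continuous f) {x y : I}
    (hy : y ∈ omegaLimitSet f x) (k : ℕ) : f^[k] y ∈ omegaLimitSet f x := by
  obtain ⟨U, hU, h⟩ := mem_omegaLimitSet_iff.1 hy
  refine mem_omegaLimitSet_of_tendsto (U := U) (g := fun n => k + n)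
    ((tendsto_atTop_mono (fun n => Nat.le_add_left n k) tendsto_id).mono_left hU) ?_
  simp only [Function.iterate_add_apply]
  exact ((hf.iterate k).tendsto y).comp h

theorem exists_modEq_mem_ultrafilter (U : Ultrafilter ℕ) (c : ℕ) {m : ℕ} (hm : 0 < m) :
    ∃ r, ∀ᶠ n in (U : Filter ℕ), n + c ≡ r [MOD m] := by
  have h : ∀ᶠ n in (U : Filter ℕ), ∃ r ∈ Set.Iio m, n + c ≡ r [MOD m] :=
    Eventually.of_forall fun n => ⟨(n + c) % m, Nat.mod_lt _ hm, (Nat.mod_modEq _ _).symm⟩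
  obtain ⟨r, -, hr⟩ := (Ultrafilter.eventually_exists_mem_iff (Set.finite_Iio m)).1 h
  exact ⟨r, hr⟩

theorem Set.OrdConnected.lt_or_lt_of_disjoint {α : Type*} [LinearOrder α] {A B : Set α}
    (hA : A.OrdConnected) (hB : B.OrdConnected) (h : Disjoint A B) :
    (∀ a ∈ A, ∀ b ∈ B, a < b) ∨ (∀ a ∈ A, ∀ b ∈ B, b < a) := by
  by_contra! hc
  obtain ⟨⟨a, ha, b, hb, hba⟩, a', ha', b', hb', hab'⟩ := hc
  have key : ∀ z, z ∈ A → z ∈ B → False := fun z h1 h2 => Set.disjoint_left.1 h h1 h2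
  rcases le_total a' b with h1 | h1
  · exact key b (hA.out ha' ha ⟨h1, hba⟩) hb
  · exact key a' ha' (hB.out hb hb' ⟨h1, hab'⟩)

/-- An order-convex set which meets three pairwise disjoint order-convex sets contains one. -/
theorem Set.OrdConnected.subset_of_three {α : Type*} [LinearOrder α] {S A B C : Set α}
    (hS : S.OrdConnected) (hA : A.OrdConnected) (hB : B.OrdConnected) (hC : C.OrdConnected)
    (hAB : Disjoint A B) (hAC : Disjoint A C) (hBC : Disjoint B C) {a b c : α}
    (ha : a ∈ A) (hb : b ∈ B) (hc : c ∈ C) (haS : a ∈ S) (hbS : b ∈ S) (hcS : c ∈ S) :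
    A ⊆ S ∨ B ⊆ S ∨ C ⊆ S := by
  have key : ∀ {X Y Z : Set α} {x z : α}, x ∈ X → z ∈ Z → x ∈ S → z ∈ S →
      (∀ x ∈ X, ∀ y ∈ Y, x < y) → (∀ y ∈ Y, ∀ z ∈ Z, y < z) → Y ⊆ S :=
    fun hx hz hxS hzS h1 h2 y hy => hS.out hxS hzS ⟨(h1 _ hx y hy).le, (h2 y hy _ hz).le⟩
  rcases hA.lt_or_lt_of_disjoint hB hAB with h1 | h1 <;>
  rcases hA.lt_or_lt_of_disjoint hC hAC with h2 | h2 <;>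
  rcases hB.lt_or_lt_of_disjoint hC hBC with h3 | h3
  · exact .inr (.inl (key ha hc haS hcS h1 h3))
  · exact .inr (.inr (key ha hb haS hbS h2 fun y hy z hz => h3 z hz y hy))
  · exact absurd ((h1 a ha b hb).trans (h3 b hb c hc)) (h2 a ha c hc).not_gt
  · exact .inl (key hc hb hcS hbS (fun y hy z hz => h2 z hz y hy) h1)
  · exact .inl (key hb hc hbS hcS (fun y hy z hz => h1 z hz y hy) h2)
  · exact absurd ((h1 a ha b hb).trans (h2 a ha c hc)) (h3 b hb c hc).not_gt
  · exact .inr (.inr (key hb ha hbS haS h3 fun y hy z hz => h2 z hz y hy))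
  · exact .inr (.inl (key hc ha hcS haS (fun y hy z hz => h3 z hz y hy)
      (fun y hy z hz => h1 z hz y hy)))

/-! ### The orbit inside the tower -/

namespace IsDyadicTower

variable {f : I → I} {K : ℕ → ℕ → Set I} {x : I}

theorem iterate_mem (hK : IsDyadicTower f K) {L r : ℕ} {y : I} (hy : y ∈ K L r) (i : ℕ) :
    f^[i] y ∈ K L (r + i) :=
  hK.image L r i ▸ Set.mem_image_of_mem _ hy

theorem modEq_of_mem (hK : IsDyadicTower f K) {L r s : ℕ} {y : I} (hr : y ∈ K L r)
    (hs : y ∈ K L s) : r ≡ s [MOD 2 ^ (L + 1)] := by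
  by_contra h
  exact Set.disjoint_left.1 (hK.disjoint L r s h) hr hs

theorem omegaLimitSet_inter_nonempty (hK : IsDyadicTower f K) (hf : Continuous f)
    (hω : ∀ L, ∀ y ∈ omegaLimitSet f x, ∃ r, y ∈ K L r) (L r : ℕ) :
    (omegaLimitSet f x ∩ K L r).Nonempty := by
  obtain ⟨y, hy⟩ := omegaLimitSet_nonempty f x
  obtain ⟨s, hs⟩ := hω L y hy
  obtain ⟨i, hi⟩ := exists_add_modEq_two_pow (L + 1) s r
  exact ⟨f^[i] y, iterate_mem_omegaLimitSet hf hy i, hK.congr L _ _ hi ▸ hK.iterate_mem hs i⟩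

/-- `K L 0` contains three distinct limit points. The orbit accumulates at the middle one, so it
enters the gap between the outer two, which lies in `K L 0` by convexity. -/
theorem exists_iterate_mem (hK : IsDyadicTower f K) (hf : Continuous f)
    (hω : ∀ L, ∀ y ∈ omegaLimitSet f x, ∃ r, y ∈ K L r) (L : ℕ) :
    ∃ n r, f^[n] x ∈ K L r := by
  have hdis : ∀ i j, i < j → j < 4 →
      Disjoint (K (L + 2) (2 ^ (L + 1) * i)) (K (L + 2) (2 ^ (L + 1) * j)) := by
    refine fun i j hij hj => hK.disjoint _ _ _ fun h => ?_
    have e : 2 ^ (L + 2 + 1) = 2 ^ (L + 1) * 4 := by ring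
    rw [e] at h
    have := Nat.ModEq.mul_left_cancel' (by positivity) h
    rw [Nat.ModEq, Nat.mod_eq_of_lt (hij.trans hj), Nat.mod_eq_of_lt hj] at this
    omega
  have hsub : ∀ i, K (L + 2) (2 ^ (L + 1) * i) ⊆ K L 0 := fun i => by
    have e : K L (2 ^ (L + 1) * i) = K L 0 := hK.congr _ _ _ (by simp [Nat.ModEq])
    exact ((hK.antitone (L + 1) _).trans (hK.antitone L _)).trans e.le
  have hne := fun i => hK.omegaLimitSet_inter_nonempty hf hω (L + 2) (2 ^ (L + 1) * i)
  choose y hyω hyK using hne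
  have hlt : ∀ i j, i < j → j < 4 → y i ≠ y j := fun i j hij hj h =>
    Set.disjoint_left.1 (hdis i j hij hj) (hyK i) (h ▸ hyK j)
  have key : ∀ a b c, y a < y b → y b < y c → ∃ n r, f^[n] x ∈ K L r := by
    intro a b c hab hbc
    obtain ⟨U, -, h⟩ := mem_omegaLimitSet_iff.1 (hyω b)
    obtain ⟨n, hn⟩ := (h.eventually (Ioo_mem_nhds hab hbc)).exists
    exact ⟨n, 0, (hK.ordConnected L 0).out (hsub a (hyK a)) (hsub c (hyK c))
      ⟨hn.1.le, hn.2.le⟩⟩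
  rcases (hlt 0 1 (by norm_num) (by norm_num)).lt_or_gt with h1 | h1 <;>
  rcases (hlt 0 2 (by norm_num) (by norm_num)).lt_or_gt with h2 | h2 <;>
  rcases (hlt 1 2 (by norm_num) (by norm_num)).lt_or_gt with h3 | h3
  · exact key _ _ _ h1 h3
  · exact key _ _ _ h2 h3
  · exact key _ _ _ h1 h3
  · exact key _ _ _ h2 h1
  · exact key _ _ _ h1 h2
  · exact key _ _ _ h1 h2
  · exact key _ _ _ h3 h2
  · exact key _ _ _ h3 h1

theorem exists_eventually_mem (hK : IsDyadicTower f K) (hf : Continuous f)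
    (hω : ∀ L, ∀ y ∈ omegaLimitSet f x, ∃ r, y ∈ K L r) (L : ℕ) :
    ∃ c, ∀ᶠ n in atTop, f^[n] x ∈ K L (n + c) := by
  obtain ⟨m, r, h⟩ := hK.exists_iterate_mem hf hω L
  obtain ⟨c, hc⟩ := exists_add_modEq_two_pow (L + 1) m r
  refine ⟨c, eventually_atTop.2 ⟨m, fun n hn => ?_⟩⟩
  obtain ⟨k, rfl⟩ := Nat.exists_eq_add_of_le hn
  have h1 := hK.iterate_mem h k
  rw [← Function.iterate_add_apply, add_comm k m] at h1
  rwa [hK.congr L (m + k + c) (r + k)]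
  rw [add_right_comm]
  exact hc.add_right k

theorem mem_of_tendsto (hK : IsDyadicTower f K) {L c r : ℕ}
    (hc : ∀ᶠ n in atTop, f^[n] x ∈ K L (n + c)) {U : Ultrafilter ℕ} {g : ℕ → ℕ} {y : I}
    (hg : Tendsto g U atTop) (hr : ∀ᶠ n in (U : Filter ℕ), g n + c ≡ r [MOD 2 ^ (L + 1)])
    (h : Tendsto (fun n => f^[g n] x) U (𝓝 y)) : y ∈ omegaLimitSet f x ∩ K L r := by
  refine ⟨mem_omegaLimitSet_of_tendsto hg h, (hK.isClosed L r).mem_of_tendsto h ?_⟩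
  filter_upwards [hr, hg.eventually hc] with n h1 h2
  rwa [← hK.congr L _ _ h1]

/-- A sequence of bad times has, along an ultrafilter, a constant residue and a convergent orbit;
the limit lies in the matching interval and contradicts badness. -/
theorem exists_dist_lt (hK : IsDyadicTower f K) {L c : ℕ}
    (hc : ∀ᶠ n in atTop, f^[n] x ∈ K L (n + c)) {η : ℝ} (hη : 0 < η) :
    ∀ᶠ n in atTop, ∃ w ∈ omegaLimitSet f x ∩ K L (n + c), dist (f^[n] x) w < η := by
  by_contra hcon
  rw [not_eventually] at hcon
  obtain ⟨U, hU, hUb⟩ : ∃ U : Ultrafilter ℕ, (U : Filter ℕ) ≤ atTop ∧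
      ∀ᶠ n in (U : Filter ℕ), ¬ ∃ w ∈ omegaLimitSet f x ∩ K L (n + c), dist (f^[n] x) w < η := by
    have := frequently_iff_neBot.1 hcon
    exact ⟨Ultrafilter.of _, (Ultrafilter.of_le _).trans inf_le_left,
      (Ultrafilter.of_le _).trans inf_le_right (mem_principal_self _)⟩
  obtain ⟨y, hy⟩ := exists_tendsto_of_ultrafilter U (fun n => f^[n] x)
  obtain ⟨r, hr⟩ := exists_modEq_mem_ultrafilter U c (m := 2 ^ (L + 1)) (by positivity)
  have hyr := hK.mem_of_tendsto hc (g := id) hU hr hy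
  obtain ⟨n, h1, h2, h3⟩ := (hUb.and (hr.and (hy.eventually (Metric.ball_mem_nhds y hη)))).exists
  exact h1 ⟨y, ⟨hyr.1, hK.congr L _ _ h2 ▸ hyr.2⟩, h3⟩

end IsDyadicTower

/-! ### Bowen distance and non-separability -/

theorem bddAbove_dist_iterate (f : I → I) (m : ℕ∞) (y z : I) :
    BddAbove (Set.range fun i : {i : ℕ // (i : ℕ∞) < m} => dist (f^[i] y) (f^[i] z)) := by
  refine ⟨1, ?_⟩
  rintro _ ⟨i, rfl⟩
  exact Real.dist_le_of_mem_Icc_01 (f^[i] y).2 (f^[i] z).2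

theorem dist_iterate_le_bowenDist (f : I → I) (y z : I) (k : ℕ) :
    dist (f^[k] y) (f^[k] z) ≤ bowenDist f ⊤ y z :=
  le_ciSup (bddAbove_dist_iterate f ⊤ y z) ⟨k, ENat.natCast_lt_top k⟩

theorem bowenDist_one (f : I → I) (y z : I) : bowenDist f 1 y z = dist y z := by
  have : Unique {i : ℕ // (i : ℕ∞) < 1} :=
    ⟨⟨⟨0, by simp⟩⟩, fun i => Subtype.ext (by have := i.2; simpa using this)⟩
  rw [bowenDist, ciSup_unique]
  have h := (default : {i : ℕ // (i : ℕ∞) < 1}).2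
  have h0 : ((default : {i : ℕ // (i : ℕ∞) < 1}) : ℕ) = 0 := by simpa using h
  rw [h0]
  rfl

theorem bowenDist_comm (f : I → I) (m : ℕ∞) (y z : I) : bowenDist f m y z = bowenDist f m z y := by
  simp only [bowenDist, dist_comm]

namespace IsDyadicTower

variable {f : I → I} {K : ℕ → ℕ → Set I} {x : I}

/-- Two trajectories of the orbit of `x` which run through `K L r` and `K L s` simultaneously
stay at least as far apart as some point over `K L s` from a given limit point over `K L r`. -/
theorem exists_dist_le_bowenDist (hK : IsDyadicTower f K) {L c : ℕ}
    (hc : ∀ᶠ n in atTop, f^[n] x ∈ K L (n + c)) {r s i j : ℕ}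
    (h : r + j ≡ s + i [MOD 2 ^ (L + 1)]) {u : I} (hu : u ∈ omegaLimitSet f x ∩ K L r) :
    ∃ v ∈ omegaLimitSet f x ∩ K L s, dist u v ≤ bowenDist f ⊤ (f^[i] x) (f^[j] x) := by
  obtain ⟨U, hU, hUu⟩ := mem_omegaLimitSet_iff.1 hu.1
  obtain ⟨r', hr'⟩ := exists_modEq_mem_ultrafilter U c (m := 2 ^ (L + 1)) (by positivity)
  have hrr := hK.modEq_of_mem (hK.mem_of_tendsto hc (g := id) hU hr' hUu).2 hu.2
  -- Compare the two orbits at time `n - i`: the first is then at `f^[n] x`, near `u`, the second at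
  -- `f^[n - i + j] x`.
  have hg : Tendsto (fun n => n - i + j) U atTop :=
    (tendsto_atTop_mono (fun n => Nat.le_add_right (n - i) j) (tendsto_sub_atTop_nat i)).mono_left hU
  obtain ⟨v, hv⟩ := exists_tendsto_of_ultrafilter U (fun n => f^[n - i + j] x)
  have hi : ∀ᶠ n in (U : Filter ℕ), i ≤ n := hU (eventually_ge_atTop i)
  refine ⟨v, hK.mem_of_tendsto hc hg ?_ hv, le_of_tendsto (hUu.dist hv) ?_⟩
  · filter_upwards [hi, hr'] with n hn h1
    refine Nat.ModEq.add_right_cancel' i ?_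
    have e : n - i + j + c + i = n + c + j := by omega
    rw [e]
    exact ((h1.trans hrr).add_right j).trans h
  · filter_upwards [hi] with n hn
    have := dist_iterate_le_bowenDist f (f^[i] x) (f^[j] x) (n - i)
    rwa [← Function.iterate_add_apply, ← Function.iterate_add_apply, Nat.sub_add_cancel hn] at this

/-- Points lying in the same interval of each level of the tower are not separable. -/
theorem not_separable (hK : IsDyadicTower f K) {u v : I}
    (huv : ∀ L, ∃ r, u ∈ K L r ∧ v ∈ K L r) : ¬ Separable f u v := by
  rintro ⟨Ju, Jv, ⟨hJu, p, hp⟩, -, hdis, hu, hv⟩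
  have hp0 := hp.period_pos
  -- At level `2 * p` the cycle has more than `2 * p` intervals, so those of `u`, `f^[p] u`, `f^[2p]
  -- u` are distinct. `Ju` meets all three, hence contains one.
  obtain ⟨r, hru, hrv⟩ := huv (2 * p)
  have hlt : 2 * p < 2 ^ (2 * p + 1) :=
    Nat.lt_two_pow_self.trans (Nat.pow_lt_pow_right (by norm_num) (by omega))
  have hJ : ∀ k, f^[p * k] u ∈ Ju := fun k => by
    have := Set.mem_image_of_mem (f^[p * k]) hu
    rwa [hp.image_iterate_mul] at this
  have hd : ∀ i j, i < j → j ≤ 2 → Disjoint (K (2 * p) (r + p * i)) (K (2 * p) (r + p * j)) := by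
    refine fun i j hij hj => hK.disjoint _ _ _ fun h => ?_
    have h' := Nat.ModEq.add_left_cancel' r h
    have h1 : p * i < p * j := Nat.mul_lt_mul_of_pos_left hij hp0
    have h2 : p * j ≤ p * 2 := Nat.mul_le_mul_left p hj
    rw [Nat.ModEq, Nat.mod_eq_of_lt (by omega), Nat.mod_eq_of_lt (by omega)] at h'
    omega
  obtain ⟨j, hj⟩ : ∃ j, K (2 * p) j ⊆ Ju := by
    have hm := fun k => hK.iterate_mem hru (p * k)
    rcases hJu.subset_of_three (hK.ordConnected _ _) (hK.ordConnected _ _) (hK.ordConnected _ _)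
      (hd 0 1 (by norm_num) (by norm_num)) (hd 0 2 (by norm_num) (by norm_num))
      (hd 1 2 (by norm_num) (by norm_num)) (hm 0) (hm 1) (hm 2) (hJ 0) (hJ 1) (hJ 2)
      with h | h | h <;> exact ⟨_, h⟩
  obtain ⟨i, hi⟩ := exists_add_modEq_two_pow (2 * p + 1) j r
  have hsub : K (2 * p) r ⊆ f^[i] '' Ju := by
    rw [← hK.congr _ _ _ hi, ← hK.image]
    exact Set.image_mono hj
  -- Both `f^[i] '' Ju` and `Ju` contain `u`, so they are the same member of the cycle of `Ju`.
  have hip : i % p = 0 % p := by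
    by_contra hne
    exact Set.disjoint_left.1 (hp.disjoint_of_mod_ne hne) (hsub hru) (by simpa using hu)
  have : v ∈ f^[i % p] '' Ju := by
    rw [← hp.image_iterate_mod]
    exact hsub hrv
  rw [hip, Nat.zero_mod, Function.iterate_zero, Set.image_id] at this
  exact Set.disjoint_left.1 hdis this hv

/-- Otherwise the pairs at distance at least `η` sharing an interval form a decreasing sequence of
nonempty compact sets; a common element is a non-separable pair of limit points. -/
theorem exists_forall_dist_lt (hK : IsDyadicTower f K)
    (hsep : ∀ y ∈ omegaLimitSet f x, ∀ z ∈ omegaLimitSet f x, ¬ NonSeparable f y z)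
    {η : ℝ} (hη : 0 < η) :
    ∃ L, ∀ r, ∀ u ∈ omegaLimitSet f x ∩ K L r, ∀ v ∈ omegaLimitSet f x ∩ K L r, dist u v < η := by
  by_contra! hcon
  let B : ℕ → Set (I × I) := fun L => {q | η ≤ dist q.1 q.2} ∩
    (omegaLimitSet f x ×ˢ omegaLimitSet f x) ∩ ⋃ r ∈ Set.Iio (2 ^ (L + 1)), K L r ×ˢ K L r
  have hmem : ∀ L q, q ∈ B L ↔ (η ≤ dist q.1 q.2 ∧ q.1 ∈ omegaLimitSet f x ∧
      q.2 ∈ omegaLimitSet f x) ∧ ∃ r, q.1 ∈ K L r ∧ q.2 ∈ K L r := by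
    intro L q
    simp only [B, Set.mem_inter_iff, Set.mem_ofPred_eq, Set.mem_prod, Set.mem_iUnion]
    refine and_congr Iff.rfl ⟨fun ⟨r, _, h⟩ => ⟨r, h⟩, fun ⟨r, h⟩ => ?_⟩
    refine ⟨r % 2 ^ (L + 1), Nat.mod_lt _ (by positivity), ?_⟩
    rwa [hK.congr L _ r (Nat.mod_modEq _ _)]
  have hcl : ∀ L, IsClosed (B L) := fun L =>
    ((isClosed_le continuous_const (continuous_fst.dist continuous_snd)).inter
      ((isClosed_omegaLimitSet f x).prod (isClosed_omegaLimitSet f x))).inter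
      ((Set.finite_Iio _).isClosed_biUnion fun r _ => (hK.isClosed L r).prod (hK.isClosed L r))
  obtain ⟨q, hq⟩ := IsCompact.nonempty_iInter_of_sequence_nonempty_isCompact_isClosed B
    (fun L q hq => by
      rw [hmem] at hq ⊢
      obtain ⟨h, r, h1, h2⟩ := hq
      exact ⟨h, r, hK.antitone L r h1, hK.antitone L r h2⟩)
    (fun L => by
      obtain ⟨r, u, hu, v, hv, h⟩ := hcon L
      exact ⟨(u, v), (hmem L _).2 ⟨⟨h, hu.1, hv.1⟩, r, hu.2, hv.2⟩⟩)
    (hcl 0).isCompact hcl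
  have hq' := fun L => (hmem L q).1 (Set.mem_iInter.1 hq L)
  obtain ⟨⟨h1, h2, h3⟩, -⟩ := hq' 0
  exact hsep _ h2 _ h3 ⟨fun h => by rw [h, dist_self] at h1; exact h1.not_gt hη,
    hK.not_separable fun L => (hq' L).2⟩

end IsDyadicTower

/-! ### Endpoint displacements and the threshold -/

/-- The bounds of a dyadic tower of cycles of closed intervals of the real line: the intervals
`[lo L r, hi L r]` of the level `L` are disjoint for `r` in distinct classes modulo `2 ^ (L + 1)`,
and `B i j` dominates the displacement of the bounds by the shift `r ↦ r + j - i`. -/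
structure IsDyadicBounds (lo hi : ℕ → ℕ → ℝ) (B : ℕ → ℕ → ℝ) : Prop where
  le : ∀ L r, lo L r ≤ hi L r
  congr : ∀ L r s, r ≡ s [MOD 2 ^ (L + 1)] → lo L r = lo L s ∧ hi L r = hi L s
  lo_le : ∀ L r, lo L r ≤ lo (L + 1) r
  hi_le : ∀ L r, hi (L + 1) r ≤ hi L r
  lt_or_lt : ∀ L r s, ¬ r ≡ s [MOD 2 ^ (L + 1)] → hi L r < lo L s ∨ hi L s < lo L r
  shift : ∀ L r s i j, r + j ≡ s + i [MOD 2 ^ (L + 1)] →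
    |lo L r - lo L s| ≤ B i j ∧ |hi L r - hi L s| ≤ B i j

/-- Both differences are odd multiples of `h`, and modulo `4h` these are only `h` and `-h`: they
agree up to sign. -/
theorem modEq_or_modEq_of_half {h a b i j : ℕ} (hab : a ≡ b [MOD h])
    (hab' : ¬ a ≡ b [MOD 2 * h]) (hij : i ≡ j [MOD h]) (hij' : ¬ i ≡ j [MOD 2 * h]) :
    a + j ≡ b + i [MOD 4 * h] ∨ b + j ≡ a + i [MOD 4 * h] := by
  simp only [Nat.modEq_iff_dvd] at *
  push_cast at *
  obtain ⟨k, hk⟩ := hab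
  obtain ⟨m, hm⟩ := hij
  have odd : ∀ {k d : ℤ}, d = h * k → ¬ (2 * (h : ℤ)) ∣ d → ∃ l, k = 2 * l + 1 := by
    intro k d hd hnd
    rcases Int.even_or_odd' k with ⟨l, rfl | rfl⟩
    · exact absurd ⟨l, by rw [hd]; ring⟩ hnd
    · exact ⟨l, rfl⟩
  obtain ⟨k', rfl⟩ := odd hk hab'
  obtain ⟨m', rfl⟩ := odd hm hij'
  rcases Int.even_or_odd' (k' - m') with ⟨l, hl | hl⟩
  · exact .inl ⟨l, by linear_combination hk - hm + 2 * (h : ℤ) * hl⟩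
  · exact .inr ⟨-(m' + l + 1), by linear_combination -hk - hm - 2 * (h : ℤ) * hl⟩

theorem not_modEq_add_half {h r : ℕ} (hh : 0 < h) : ¬ r ≡ r + h [MOD 2 * h] := by
  intro H
  have h0 : r + 0 ≡ r + h [MOD 2 * h] := H
  have := Nat.ModEq.add_left_cancel' r h0
  rw [Nat.ModEq, Nat.zero_mod, Nat.mod_eq_of_lt (by omega)] at this
  omega

namespace IsDyadicBounds

variable {lo hi : ℕ → ℕ → ℝ} {B : ℕ → ℕ → ℝ}

/-- The values of the bounds on the levels up to `L`. -/
def values (lo hi : ℕ → ℕ → ℝ) (L : ℕ) : Set ℝ :=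
  ⋃ l ∈ Set.Iic L, Set.range (lo l) ∪ Set.range (hi l)

theorem lo_mem_values {l L : ℕ} (h : l ≤ L) (r : ℕ) : lo l r ∈ values lo hi L :=
  Set.mem_biUnion h (.inl ⟨r, rfl⟩)

theorem hi_mem_values {l L : ℕ} (h : l ≤ L) (r : ℕ) : hi l r ∈ values lo hi L :=
  Set.mem_biUnion h (.inr ⟨r, rfl⟩)

theorem finite_values (H : IsDyadicBounds lo hi B) (L : ℕ) : (values lo hi L).Finite := by
  refine (Set.finite_Iic L).biUnion fun l _ => Set.Finite.union ?_ ?_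
  · refine ((Set.finite_Iio (2 ^ (l + 1))).image (lo l)).subset ?_
    rintro _ ⟨r, rfl⟩
    exact ⟨r % 2 ^ (l + 1), Nat.mod_lt _ (by positivity), (H.congr l _ _ (Nat.mod_modEq _ _)).1⟩
  · refine ((Set.finite_Iio (2 ^ (l + 1))).image (hi l)).subset ?_
    rintro _ ⟨r, rfl⟩
    exact ⟨r % 2 ^ (l + 1), Nat.mod_lt _ (by positivity), (H.congr l _ _ (Nat.mod_modEq _ _)).2⟩

/-- The shift carries interval `r` to a disjoint one, so its lower end (moving right) or its upper
end (moving left) travels more than its length. The witness `e` comes from a finite set independent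
of `i` and `j`, which later yields a uniform gap above `β`. -/
theorem exists_length_lt (H : IsDyadicBounds lo hi B) {l L i j : ℕ} (hl : l ≤ L)
    (hij : ¬ i ≡ j [MOD 2 ^ (l + 1)]) (r : ℕ) :
    ∃ e ∈ Set.image2 (fun y z : ℝ => |y - z|) (values lo hi L) (values lo hi L),
      e ≤ B i j ∧ hi l r - lo l r < e := by
  obtain ⟨t, ht⟩ := exists_add_modEq_two_pow (l + 1) i (r + j)
  have hs : r + j ≡ t + i [MOD 2 ^ (l + 1)] := by rw [add_comm t]; exact ht.symm
  obtain ⟨h1, h2⟩ := H.shift l r t i j hs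
  have hne : ¬ r ≡ t [MOD 2 ^ (l + 1)] := fun h =>
    hij (Nat.ModEq.add_left_cancel h hs).symm
  have := H.le l r
  have := H.le l t
  rcases H.lt_or_lt l r t hne with h | h
  · refine ⟨_, ⟨_, lo_mem_values hl r, _, lo_mem_values hl t, rfl⟩, h1, ?_⟩
    have := neg_abs_le (lo l r - lo l t)
    linarith
  · refine ⟨_, ⟨_, hi_mem_values hl r, _, hi_mem_values hl t, rfl⟩, h2, ?_⟩
    have := le_abs_self (hi l r - hi l t)
    linarith

/-- Of the two halves of an interval of the level `L + 1`, one is the right one. -/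
theorem exists_right_half (H : IsDyadicBounds lo hi B) (L r : ℕ) :
    ∃ a a', a ≡ r [MOD 2 ^ (L + 1)] ∧ a' ≡ r [MOD 2 ^ (L + 1)] ∧ hi (L + 1) a' < lo (L + 1) a := by
  have hr : r + 2 ^ (L + 1) ≡ r [MOD 2 ^ (L + 1)] := by simp [Nat.ModEq]
  have hne : ¬ r ≡ r + 2 ^ (L + 1) [MOD 2 ^ (L + 1 + 1)] := by
    rw [pow_succ' 2 (L + 1)]
    exact not_modEq_add_half (by positivity)
  rcases H.lt_or_lt _ _ _ hne with h | h
  · exact ⟨_, _, hr, rfl, h⟩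
  · exact ⟨_, _, rfl, hr, h⟩

theorem exists_left_half (H : IsDyadicBounds lo hi B) (L r : ℕ) :
    ∃ a a', a ≡ r [MOD 2 ^ (L + 1)] ∧ a' ≡ r [MOD 2 ^ (L + 1)] ∧ hi (L + 1) a < lo (L + 1) a' := by
  obtain ⟨a, a', h1, h2, h3⟩ := H.exists_right_half L r
  exact ⟨a', a, h2, h1, h3⟩

/-- Two quarters `a`, `b` of an interval, adjacent in position and lying in different halves of it,
whose convex hull is shorter than any displacement by a shift that is not a multiple of the period
of the halves. -/
theorem exists_adjacent_quarters (H : IsDyadicBounds lo hi B) (L r : ℕ) :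
    ∃ a b, a ≡ r [MOD 2 ^ (L + 1)] ∧ b ≡ r [MOD 2 ^ (L + 1)] ∧ ¬ a ≡ b [MOD 2 ^ (L + 2)] ∧
      hi (L + 2) a < lo (L + 2) b ∧ hi (L + 2) b - lo (L + 2) a ≤ hi L r - lo L r ∧
      ∀ i j, ¬ i ≡ j [MOD 2 ^ (L + 2)] →
        ∃ e ∈ Set.image2 (fun y z : ℝ => |y - z|) (values lo hi (L + 2)) (values lo hi (L + 2)),
          e ≤ B i j ∧ hi (L + 2) b - lo (L + 2) a < e := by
  have two : 2 ^ (L + 2) = 2 * 2 ^ (L + 1) := by ring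
  have four : 2 ^ (L + 2 + 1) = 4 * 2 ^ (L + 1) := by ring
  -- `p` is the left half and `q` the right one; from left to right the quarters are `a'`, `a`, `b`,
  -- `b'`.
  obtain ⟨q, p, hq, hp, hpq⟩ := H.exists_right_half L r
  obtain ⟨a, a', ha, ha', haa⟩ := H.exists_right_half (L + 1) p
  obtain ⟨b, b', hb, hb', hbb⟩ := H.exists_left_half (L + 1) q
  have hdvd : 2 ^ (L + 1) ∣ 2 ^ (L + 1 + 1) := pow_dvd_pow 2 (Nat.le_succ _)
  have hpq' : ¬ p ≡ q [MOD 2 ^ (L + 1 + 1)] := fun h => by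
    have := (H.congr _ _ _ h).1
    have := H.le (L + 1) p
    linarith
  have har : a ≡ r [MOD 2 ^ (L + 1)] := (ha.of_dvd hdvd).trans hp
  have hbr : b ≡ r [MOD 2 ^ (L + 1)] := (hb.of_dvd hdvd).trans hq
  have ha'r : a' ≡ r [MOD 2 ^ (L + 1)] := (ha'.of_dvd hdvd).trans hp
  have hb'r : b' ≡ r [MOD 2 ^ (L + 1)] := (hb'.of_dvd hdvd).trans hq
  have hla := H.lo_le (L + 1) a
  rw [(H.congr _ _ _ ha).1] at hla
  have hha := H.hi_le (L + 1) a
  rw [(H.congr _ _ _ ha).2] at hha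
  have hlb := H.lo_le (L + 1) b
  rw [(H.congr _ _ _ hb).1] at hlb
  have hhb := H.hi_le (L + 1) b
  rw [(H.congr _ _ _ hb).2] at hhb
  have hlp := H.lo_le L p
  rw [(H.congr _ _ _ hp).1] at hlp
  have hhq := H.hi_le L q
  rw [(H.congr _ _ _ hq).2] at hhq
  simp only [show L + 1 + 1 = L + 2 from rfl] at *
  have hlen : hi (L + 2) b - lo (L + 2) a ≤ hi L r - lo L r := by linarith
  refine ⟨a, b, har, hbr, fun h => hpq' (ha.symm.trans (h.trans hb)), by linarith, hlen, ?_⟩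
  intro i j hij
  -- If `i - j` is an odd multiple of `h`, the shift exchanges the outer quarters in one direction,
  -- and their upper ends are farther apart than the hull of `a` and `b` is long. Otherwise interval
  -- `r` itself is moved off.
  by_cases hij' : i ≡ j [MOD 2 ^ (L + 1)]
  · have hle1 := H.le (L + 2) a
    have hle2 := H.le (L + 2) b
    have hle3 := H.le (L + 2) a'
    have hle4 := H.le (L + 2) b'
    have hab : ¬ a' ≡ b' [MOD 2 * 2 ^ (L + 1)] := fun h => by
      rw [← two] at h
      exact hpq' (ha'.symm.trans (h.trans hb'))
    rcases modEq_or_modEq_of_half (ha'r.trans hb'r.symm) hab hij' (two ▸ hij) with h | h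
    · refine ⟨_, ⟨_, hi_mem_values le_rfl a', _, hi_mem_values le_rfl b', rfl⟩,
        (H.shift (L + 2) _ _ i j (four ▸ h)).2, ?_⟩
      have := neg_abs_le (hi (L + 2) a' - hi (L + 2) b')
      linarith
    · refine ⟨_, ⟨_, hi_mem_values le_rfl b', _, hi_mem_values le_rfl a', rfl⟩,
        (H.shift (L + 2) _ _ i j (four ▸ h)).2, ?_⟩
      have := le_abs_self (hi (L + 2) b' - hi (L + 2) a')
      linarith
  · obtain ⟨e, he, h1, h2⟩ := H.exists_length_lt (Nat.le_add_right L 2) hij' r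
    exact ⟨e, he, h1, hlen.trans_lt h2⟩

/-- `β` is the maximum of finitely many lengths. Whichever kind attains it, a shift that is not a
multiple of `2 ^ (L + 2)` displaces some endpoint by more than `β`. -/
theorem exists_threshold (H : IsDyadicBounds lo hi B) (L : ℕ) :
    ∃ (β : ℝ) (a b : ℕ → ℕ), 0 ≤ β ∧ (∃ r, β ≤ hi L r - lo L r) ∧
      (∀ r, hi (L + 1) r - lo (L + 1) r ≤ β) ∧
      (∀ r, a r ≡ r [MOD 2 ^ (L + 1)] ∧ b r ≡ r [MOD 2 ^ (L + 1)] ∧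
        ¬ a r ≡ b r [MOD 2 ^ (L + 2)] ∧ hi (L + 2) (a r) < lo (L + 2) (b r) ∧
        hi (L + 2) (b r) - lo (L + 2) (a r) ≤ β) ∧
      ∀ᶠ ε in 𝓝[>] β, ∀ i j, B i j ≤ ε → i ≡ j [MOD 2 ^ (L + 2)] := by
  choose a b ha hb hab hlt hlen hB using H.exists_adjacent_quarters L
  let V := values lo hi (L + 2)
  have hV : V.Finite := H.finite_values (L + 2)
  let F : Set ℝ := Set.range (fun r => hi (L + 1) r - lo (L + 1) r) ∪
    Set.range (fun r => hi (L + 2) (b r) - lo (L + 2) (a r))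
  have hF : F.Finite := by
    refine (hV.image2 (fun y z : ℝ => y - z) hV).subset ?_
    rintro _ (⟨r, rfl⟩ | ⟨r, rfl⟩)
    · exact ⟨_, hi_mem_values (by omega) r, _, lo_mem_values (by omega) r, rfl⟩
    · exact ⟨_, hi_mem_values (by omega) _, _, lo_mem_values (by omega) _, rfl⟩
  obtain ⟨β, hβF, hβ⟩ := Set.exists_max_image F id hF ⟨_, .inl ⟨0, rfl⟩⟩
  have hβ1 : ∀ r, hi (L + 1) r - lo (L + 1) r ≤ β := fun r => hβ _ (.inl ⟨r, rfl⟩)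
  have hβ2 : ∀ r, hi (L + 2) (b r) - lo (L + 2) (a r) ≤ β := fun r => hβ _ (.inr ⟨r, rfl⟩)
  refine ⟨β, a, b, ?_, ?_, hβ1, fun r => ⟨ha r, hb r, hab r, hlt r, hβ2 r⟩, ?_⟩
  · have := H.le (L + 1) 0
    have := hβ1 0
    linarith
  · rcases hβF with ⟨r, rfl⟩ | ⟨r, rfl⟩
    · exact ⟨r, sub_le_sub (H.hi_le L r) (H.lo_le L r)⟩
    · exact ⟨r, hlen r⟩
  · have hgap : ∀ᶠ ε in 𝓝[>] β, ∀ e ∈ Set.image2 (fun y z : ℝ => |y - z|) V V, β < e → ε < e := by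
      rw [eventually_all_finite (hV.image2 _ hV)]
      intro e _
      by_cases he : β < e
      · filter_upwards [Ioo_mem_nhdsGT he] with ε hε _
        exact hε.2
      · exact Eventually.of_forall fun ε h => absurd h he
    filter_upwards [hgap] with ε hε i j hij
    by_contra hne
    have : ∃ e ∈ Set.image2 (fun y z : ℝ => |y - z|) V V, e ≤ B i j ∧ β < e := by
      rcases hβF with ⟨r, rfl⟩ | ⟨r, rfl⟩
      · exact H.exists_length_lt (by omega) hne r
      · exact hB r i j hne
    obtain ⟨e, he, h1, h2⟩ := this
    exact ((hε e he h2).trans_le h1).not_ge hij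

end IsDyadicBounds

/-! ### Counting pairs by residues -/

/-- The number of pairs in a box whose residues lie in a given set of pairs of residues. -/
theorem card_mul_sq_le_card_filter (M N c n : ℕ) (hM : 0 < M) (S : Finset (ℕ × ℕ))
    (hS : ∀ q ∈ S, q.1 < M ∧ q.2 < M) (P : ℕ × ℕ → Prop) [DecidablePred P]
    (hP : ∀ i j, N ≤ i → N ≤ j → ((i + c) % M, (j + c) % M) ∈ S → P (i, j)) :
    S.card * ((n - N) / M) ^ 2 ≤
      ((Finset.range n ×ˢ Finset.range n).filter P).card := by
  have hs : ∀ q, ∃ s, s < M ∧ (q < M → (N + s + c) % M = q) := by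
    intro q
    -- The offset solving `N + s + c ≡ q` modulo `M`.
    refine ⟨(q + (M - (N + c) % M)) % M, Nat.mod_lt _ hM, fun hq => ?_⟩
    have h1 := (Nat.mod_lt (N + c) hM).le
    have e : N + (q + (M - (N + c) % M)) + c = q + (M - (N + c) % M) + (N + c) := by ring
    have : (N + (q + (M - (N + c) % M)) % M + c) ≡ q [MOD M] := by
      have e1 : (N + (q + (M - (N + c) % M)) % M + c) ≡ N + (q + (M - (N + c) % M)) + c [MOD M] :=
        ((Nat.mod_modEq _ _).add_left N).add_right c
      refine e1.trans ?_
      rw [e]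
      have e2 : q + (M - (N + c) % M) + (N + c) ≡ q + (M - (N + c) % M) + (N + c) % M [MOD M] :=
        (Nat.mod_modEq _ _).symm.add_left _
      refine e2.trans ?_
      rw [add_assoc, Nat.sub_add_cancel h1]
      simp [Nat.ModEq]
    rw [this, Nat.mod_eq_of_lt hq]
  choose s hsM hsq using hs
  have hcard : S.card * ((n - N) / M) ^ 2 =
      (S ×ˢ Finset.range ((n - N) / M) ×ˢ Finset.range ((n - N) / M)).card := by
    simp [Finset.card_product, sq]
  rw [hcard]
  have hlt : ∀ q k, k < (n - N) / M → N + (M * k + s q) < n := by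
    intro q k hk
    have h1 : M * (k + 1) ≤ n - N := (Nat.mul_le_mul_left M hk).trans (Nat.mul_div_le _ _)
    have := hsM q
    rw [Nat.mul_succ] at h1
    omega
  have hmod : ∀ q k, q < M → (N + (M * k + s q) + c) % M = q := by
    intro q k hq
    have e : N + (M * k + s q) + c = M * k + (N + s q + c) := by ring
    rw [e, Nat.mul_add_mod, hsq q hq]
  refine Finset.card_le_card_of_injOn
    (fun z => (N + (M * z.2.1 + s z.1.1), N + (M * z.2.2 + s z.1.2))) ?_ ?_
  · rintro ⟨⟨q1, q2⟩, k1, k2⟩ hz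
    simp only [Finset.coe_product, Set.mem_prod, Finset.mem_coe, Finset.mem_range] at hz
    obtain ⟨hq, hk1, hk2⟩ := hz
    simp only [Finset.coe_filter, Set.mem_ofPred_eq, Finset.mem_product, Finset.mem_range]
    refine ⟨⟨hlt _ _ hk1, hlt _ _ hk2⟩, hP _ _ (Nat.le_add_right _ _) (Nat.le_add_right _ _) ?_⟩
    rwa [hmod _ _ (hS _ hq).1, hmod _ _ (hS _ hq).2]
  · rintro ⟨⟨q1, q2⟩, k1, k2⟩ hz ⟨⟨q1', q2'⟩, k1', k2'⟩ hz' heq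
    simp only [Finset.coe_product, Set.mem_prod, Finset.mem_coe] at hz hz'
    have hq := hS _ hz.1
    have hq' := hS _ hz'.1
    simp only [Prod.mk.injEq] at heq
    have inj : ∀ {q q' k k' : ℕ}, q < M → q' < M → N + (M * k + s q) = N + (M * k' + s q') →
        q = q' ∧ k = k' := by
      intro q q' k k' h1 h2 h
      have e : q = q' := by rw [← hmod q k h1, h, hmod q' k' h2]
      refine ⟨e, ?_⟩
      subst e
      exact Nat.eq_of_mul_eq_mul_left hM (by omega)
    obtain ⟨rfl, rfl⟩ := inj hq.1 hq'.1 heq.1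
    obtain ⟨rfl, rfl⟩ := inj hq.2 hq'.2 heq.2
    rfl

/-- For fixed `i`, each block of `m` consecutive integers contains at most one admissible `j`. -/
theorem card_filter_modEq_le (m n : ℕ) (P : ℕ × ℕ → Prop) [DecidablePred P]
    (hP : ∀ i j, P (i, j) → i ≡ j [MOD m]) :
    ((Finset.range n ×ˢ Finset.range n).filter P).card ≤ n * (n / m + 1) := by
  have : ((Finset.range n ×ˢ Finset.range n).filter P).card ≤
      (Finset.range n ×ˢ Finset.range (n / m + 1)).card := by
    refine Finset.card_le_card_of_injOn (fun z => (z.1, z.2 / m)) ?_ ?_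
    · rintro ⟨i, j⟩ hz
      simp only [Finset.coe_filter, Set.mem_ofPred_eq, Finset.mem_product, Finset.mem_range] at hz
      simp only [Finset.coe_product, Set.mem_prod, Finset.mem_coe, Finset.mem_range]
      exact ⟨hz.1.1, Nat.lt_succ_of_le (Nat.div_le_div_right hz.1.2.le)⟩
    · rintro ⟨i, j⟩ hz ⟨i', j'⟩ hz' heq
      simp only [Finset.coe_filter, Set.mem_ofPred_eq] at hz hz'
      simp only [Prod.mk.injEq] at heq
      obtain ⟨rfl, hd⟩ := heq
      have hmod : j % m = j' % m := (hP _ _ hz.2).symm.trans (hP _ _ hz'.2)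
      rw [← Nat.mod_add_div j m, ← Nat.mod_add_div j' m, hmod, hd]
  simpa [Finset.card_product] using this

/-- A set of at least `10 h` pairs of residues modulo `4 h`: the pairs congruent modulo `2 h` and,
for each class modulo `h`, two more. -/
theorem exists_residue_pairs (h : ℕ) (hh : 0 < h) (a b : ℕ → ℕ)
    (hab : ∀ r, a r ≡ r [MOD h] ∧ b r ≡ r [MOD h] ∧ ¬ a r ≡ b r [MOD 2 * h]) :
    ∃ S : Finset (ℕ × ℕ), S.card = 10 * h ∧ (∀ q ∈ S, q.1 < 4 * h ∧ q.2 < 4 * h) ∧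
      ∀ q ∈ S, q.1 ≡ q.2 [MOD 2 * h] ∨
        ∃ r, q.1 ≡ a r [MOD 4 * h] ∧ q.2 ≡ b r [MOD 4 * h] ∨
          q.1 ≡ b r [MOD 4 * h] ∧ q.2 ≡ a r [MOD 4 * h] := by
  have hM : 0 < 4 * h := by omega
  have hd2 : 2 * h ∣ 4 * h := ⟨2, by ring⟩
  have hd1 : h ∣ 4 * h := ⟨4, by ring⟩
  -- `S0` holds the `8h` pairs congruent modulo `2h`; `S1` and `S2` hold the `h` facing pairs in
  -- either order.
  let S0 := (Finset.range (4 * h) ×ˢ Finset.range 2).image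
    fun z => (z.1, (z.1 + 2 * h * z.2) % (4 * h))
  let S1 := (Finset.range h).image fun r => (a r % (4 * h), b r % (4 * h))
  let S2 := (Finset.range h).image fun r => (b r % (4 * h), a r % (4 * h))
  have hclass : ∀ {u v r s : ℕ}, u ≡ r [MOD h] → v ≡ s [MOD h] → u % (4 * h) = v % (4 * h) →
      r < h → s < h → r = s := by
    intro u v r s hu hv huv hr hs
    have : r ≡ s [MOD h] := hu.symm.trans ((Nat.ModEq.of_dvd hd1 huv).trans hv)
    rwa [Nat.ModEq, Nat.mod_eq_of_lt hr, Nat.mod_eq_of_lt hs] at this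
  have hS0 : ∀ q ∈ S0, q.1 < 4 * h ∧ q.2 < 4 * h ∧ q.1 ≡ q.2 [MOD 2 * h] := by
    intro q hq
    obtain ⟨z, hz, rfl⟩ := Finset.mem_image.1 hq
    rw [Finset.mem_product, Finset.mem_range] at hz
    refine ⟨hz.1, Nat.mod_lt _ hM, ?_⟩
    refine Nat.ModEq.trans ?_ (Nat.ModEq.of_dvd hd2 (Nat.mod_modEq _ _)).symm
    simp [Nat.ModEq]
  have hS1 : ∀ q ∈ S1, ∃ r < h, q = (a r % (4 * h), b r % (4 * h)) := by
    intro q hq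
    obtain ⟨r, hr, rfl⟩ := Finset.mem_image.1 hq
    exact ⟨r, Finset.mem_range.1 hr, rfl⟩
  have hS2 : ∀ q ∈ S2, ∃ r < h, q = (b r % (4 * h), a r % (4 * h)) := by
    intro q hq
    obtain ⟨r, hr, rfl⟩ := Finset.mem_image.1 hq
    exact ⟨r, Finset.mem_range.1 hr, rfl⟩
  have hne : ∀ r, ¬ a r % (4 * h) ≡ b r % (4 * h) [MOD 2 * h] := fun r H =>
    (hab r).2.2 ((Nat.ModEq.of_dvd hd2 (Nat.mod_modEq _ _)).symm.trans
      (H.trans (Nat.ModEq.of_dvd hd2 (Nat.mod_modEq _ _))))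
  have c0 : S0.card = 8 * h := by
    rw [Finset.card_image_of_injOn]
    · rw [Finset.card_product, Finset.card_range, Finset.card_range]
      ring
    · rintro ⟨q, k⟩ hz ⟨q', k'⟩ hz' heq
      simp only [Finset.coe_product, Set.mem_prod, Finset.mem_coe, Finset.mem_range] at hz hz'
      simp only [Prod.mk.injEq] at heq
      obtain ⟨rfl, h2⟩ := heq
      have h3 := Nat.ModEq.add_left_cancel' q h2
      have e : ∀ k < 2, 2 * h * k < 4 * h := fun k hk => by
        have := Nat.mul_le_mul_left (2 * h) (Nat.le_of_lt_succ hk)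
        omega
      rw [Nat.ModEq, Nat.mod_eq_of_lt (e k hz.2), Nat.mod_eq_of_lt (e k' hz'.2)] at h3
      rw [Nat.eq_of_mul_eq_mul_left (by omega) h3]
  have c1 : S1.card = h := by
    rw [Finset.card_image_of_injOn, Finset.card_range]
    intro r hr s hs heq
    simp only [Prod.mk.injEq] at heq
    exact hclass (hab r).1 (hab s).1 heq.1 (Finset.mem_range.1 hr) (Finset.mem_range.1 hs)
  have c2 : S2.card = h := by
    rw [Finset.card_image_of_injOn, Finset.card_range]
    intro r hr s hs heq
    simp only [Prod.mk.injEq] at heq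
    exact hclass (hab r).1 (hab s).1 heq.2 (Finset.mem_range.1 hr) (Finset.mem_range.1 hs)
  have d12 : Disjoint S1 S2 := by
    rw [Finset.disjoint_left]
    intro q h1 h2
    obtain ⟨r, hr, rfl⟩ := hS1 q h1
    obtain ⟨s, hs, heq⟩ := hS2 _ h2
    simp only [Prod.mk.injEq] at heq
    obtain rfl := hclass (hab r).1 (hab s).2.1 heq.1 hr hs
    exact hne r (by rw [heq.1])
  have d0 : Disjoint S0 (S1 ∪ S2) := by
    rw [Finset.disjoint_left]
    intro q h0 h12
    have h0 := (hS0 q h0).2.2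
    rcases Finset.mem_union.1 h12 with h | h
    · obtain ⟨r, -, rfl⟩ := hS1 q h
      exact hne r h0
    · obtain ⟨r, -, rfl⟩ := hS2 q h
      exact hne r h0.symm
  refine ⟨S0 ∪ (S1 ∪ S2), ?_, ?_, ?_⟩
  · rw [Finset.card_union_of_disjoint d0, Finset.card_union_of_disjoint d12, c0, c1, c2]
    ring
  · intro q hq
    rcases Finset.mem_union.1 hq with h | h
    · exact ⟨(hS0 q h).1, (hS0 q h).2.1⟩
    rcases Finset.mem_union.1 h with h | h
    · obtain ⟨r, -, rfl⟩ := hS1 q h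
      exact ⟨Nat.mod_lt _ hM, Nat.mod_lt _ hM⟩
    · obtain ⟨r, -, rfl⟩ := hS2 q h
      exact ⟨Nat.mod_lt _ hM, Nat.mod_lt _ hM⟩
  · intro q hq
    rcases Finset.mem_union.1 hq with h | h
    · exact .inl (hS0 q h).2.2
    rcases Finset.mem_union.1 h with h | h
    · obtain ⟨r, -, rfl⟩ := hS1 q h
      exact .inr ⟨r, .inl ⟨Nat.mod_modEq _ _, Nat.mod_modEq _ _⟩⟩
    · obtain ⟨r, -, rfl⟩ := hS2 q h
      exact .inr ⟨r, .inr ⟨Nat.mod_modEq _ _, Nat.mod_modEq _ _⟩⟩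

/-! ### Hulls of the limit points in the tower -/

theorem abs_sub_le_of_isLeast {A B : Set I} {a b : I} {d : ℝ} (ha : IsLeast A a)
    (hb : IsLeast B b) (hAB : ∀ u ∈ A, ∃ v ∈ B, dist u v ≤ d)
    (hBA : ∀ v ∈ B, ∃ u ∈ A, dist v u ≤ d) : |(a : ℝ) - b| ≤ d := by
  obtain ⟨v, hv, h1⟩ := hAB a ha.1
  obtain ⟨u, hu, h2⟩ := hBA b hb.1
  have e1 : (b : ℝ) ≤ v := hb.2 hv
  have e2 : (a : ℝ) ≤ u := ha.2 hu
  rw [Subtype.dist_eq, Real.dist_eq, abs_le] at h1 h2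
  rw [abs_le]
  constructor <;> linarith

theorem abs_sub_le_of_isGreatest {A B : Set I} {a b : I} {d : ℝ} (ha : IsGreatest A a)
    (hb : IsGreatest B b) (hAB : ∀ u ∈ A, ∃ v ∈ B, dist u v ≤ d)
    (hBA : ∀ v ∈ B, ∃ u ∈ A, dist v u ≤ d) : |(a : ℝ) - b| ≤ d := by
  obtain ⟨v, hv, h1⟩ := hAB a ha.1
  obtain ⟨u, hu, h2⟩ := hBA b hb.1
  have e1 : (v : ℝ) ≤ b := hb.2 hv
  have e2 : (u : ℝ) ≤ a := ha.2 hu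
  rw [Subtype.dist_eq, Real.dist_eq, abs_le] at h1 h2
  rw [abs_le]
  constructor <;> linarith

theorem IsDyadicTower.exists_bounds {f : I → I} {K : ℕ → ℕ → Set I} {x : I}
    (hK : IsDyadicTower f K) (hf : Continuous f)
    (hω : ∀ L, ∀ y ∈ omegaLimitSet f x, ∃ r, y ∈ K L r) :
    ∃ lo hi : ℕ → ℕ → I,
      (∀ L r, IsLeast (omegaLimitSet f x ∩ K L r) (lo L r)) ∧
      (∀ L r, IsGreatest (omegaLimitSet f x ∩ K L r) (hi L r)) ∧
      IsDyadicBounds (fun L r => (lo L r : ℝ)) (fun L r => (hi L r : ℝ))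
        (fun i j => bowenDist f ⊤ (f^[i] x) (f^[j] x)) := by
  have hcpt : ∀ L r, IsCompact (omegaLimitSet f x ∩ K L r) := fun L r =>
    ((isClosed_omegaLimitSet f x).inter (hK.isClosed L r)).isCompact
  have hne := hK.omegaLimitSet_inter_nonempty hf hω
  choose lo hlo using fun L r => (hcpt L r).exists_isLeast (hne L r)
  choose hi hhi using fun L r => (hcpt L r).exists_isGreatest (hne L r)
  refine ⟨lo, hi, hlo, hhi, ⟨?_, ?_, ?_, ?_, ?_, ?_⟩⟩
  · exact fun L r => (hlo L r).2 (hhi L r).1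
  · intro L r s h
    have e := hK.congr L r s h
    constructor
    · exact congrArg _ ((hlo L r).unique (e ▸ hlo L s))
    · exact congrArg _ ((hhi L r).unique (e ▸ hhi L s))
  · exact fun L r => (hlo L r).2 ⟨(hlo (L + 1) r).1.1, hK.antitone L r (hlo (L + 1) r).1.2⟩
  · exact fun L r => (hhi L r).2 ⟨(hhi (L + 1) r).1.1, hK.antitone L r (hhi (L + 1) r).1.2⟩
  · intro L r s h
    refine ((hK.ordConnected L r).lt_or_lt_of_disjoint (hK.ordConnected L s)
      (hK.disjoint L r s h)).imp (fun H => ?_) (fun H => ?_)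
    · exact H _ (hhi L r).1.2 _ (hlo L s).1.2
    · exact H _ (hlo L r).1.2 _ (hhi L s).1.2
  -- Each of the two sets of limit points lies within `B i j` of the other, so their extreme points
  -- do too.
  · intro L r s i j h
    obtain ⟨c, hc⟩ := hK.exists_eventually_mem hf hω L
    have h1 : ∀ u ∈ omegaLimitSet f x ∩ K L r, ∃ v ∈ omegaLimitSet f x ∩ K L s,
        dist u v ≤ bowenDist f ⊤ (f^[i] x) (f^[j] x) := fun u hu =>
      hK.exists_dist_le_bowenDist hc h hu
    have h2 : ∀ v ∈ omegaLimitSet f x ∩ K L s, ∃ u ∈ omegaLimitSet f x ∩ K L r,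
        dist v u ≤ bowenDist f ⊤ (f^[i] x) (f^[j] x) := fun v hv => by
      rw [bowenDist_comm]
      exact hK.exists_dist_le_bowenDist hc h.symm hv
    exact ⟨abs_sub_le_of_isLeast (hlo L r) (hlo L s) h1 h2,
      abs_sub_le_of_isGreatest (hhi L r) (hhi L s) h1 h2⟩

/-! ### Asymptotics of the determinism -/

theorem rdet_nonneg (f : I → I) (m : ℕ∞) (x : I) (n : ℕ) (ε : ℝ) : 0 ≤ rdet f m x n ε := by
  unfold rdet corrSum
  positivity

theorem rdet_top_le_one (f : I → I) (x : I) (n : ℕ) (ε : ℝ) : rdet f ⊤ x n ε ≤ 1 := by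
  refine div_le_one_of_le₀ ?_ (by unfold corrSum; positivity)
  unfold corrSum
  gcongr with ij
  rw [bowenDist_one]
  exact dist_iterate_le_bowenDist f _ _ 0

theorem upperRdet_nonneg (f : I → I) (x : I) (ε : ℝ) : 0 ≤ upperRdet f ⊤ x ε :=
  le_limsup_of_frequently_le (Frequently.of_forall fun n => rdet_nonneg f ⊤ x n ε)
    (isBoundedUnder_of ⟨1, fun n => rdet_top_le_one f x n ε⟩)

theorem tendsto_four_fifths_mul (a b : ℝ) :
    Tendsto (fun n : ℕ => 4 / 5 * ((n : ℝ) * (n + a) / (n - b) ^ 2)) atTop (𝓝 (4 / 5)) := by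
  have h0 : ∀ d : ℝ, Tendsto (fun n : ℕ => 1 + d / (n : ℝ)) atTop (𝓝 1) := fun d => by
    simpa using (tendsto_const_div_atTop_nhds_zero_nat d).const_add 1
  have h := (((h0 a).div ((h0 (-b)).pow 2) (by norm_num)).const_mul (4 / 5 : ℝ))
  norm_num at h
  refine h.congr' ?_
  filter_upwards [eventually_gt_atTop 0] with n hn
  have hn' : (n : ℝ) ≠ 0 := by positivity
  have e1 : 1 + a / (n : ℝ) = (n + a) / n := by field_simp
  have e2 : 1 + -b / (n : ℝ) = (n - b) / n := by field_simp; ring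
  rw [e1, e2, div_pow, div_div_div_eq]
  congr 1
  rw [show ((n : ℝ) + a) * n ^ 2 = n * (n * (n + a)) by ring, mul_div_mul_left _ _ hn']

/-- To leading order the numerator is `n² / (2h)` and the denominator `10h · (n / (4h))² = 5n² /
(8h)`. -/
theorem div_le_four_fifths_mul {h : ℕ} (hh : 0 < h) {p q n N : ℕ} (hn : N + 4 * h < n)
    (hp : p ≤ n * (n / (2 * h) + 1)) (hq : 10 * h * ((n - N) / (4 * h)) ^ 2 ≤ q) :
    (p : ℝ) / q ≤ 4 / 5 * ((n : ℝ) * (n + (2 * h : ℕ)) / (n - (N + 4 * h : ℕ)) ^ 2) := by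
  have hh' : (0 : ℝ) < h := by exact_mod_cast hh
  have hpos : (0 : ℝ) < (n : ℝ) - (N + 4 * h : ℕ) := by
    have : ((N + 4 * h : ℕ) : ℝ) < n := by exact_mod_cast hn
    linarith
  have hp' : (p : ℝ) ≤ n * (n + (2 * h : ℕ)) / (2 * h) := by
    have h1 : (p : ℝ) ≤ n * ((n / (2 * h) : ℕ) + 1) := by exact_mod_cast hp
    have h2 : ((n / (2 * h) : ℕ) : ℝ) ≤ n / (2 * h) := by
      have := @Nat.cast_div_le ℝ _ _ _ n (2 * h)
      push_cast at this
      exact this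
    refine h1.trans ?_
    rw [mul_div_assoc]
    refine mul_le_mul_of_nonneg_left ?_ (Nat.cast_nonneg n)
    rw [add_div]
    push_cast
    rw [div_self (by positivity)]
    linarith
  have hq' : 5 / (8 * h) * ((n : ℝ) - (N + 4 * h : ℕ)) ^ 2 ≤ q := by
    have h1 : 10 * (h : ℝ) * (((n - N) / (4 * h) : ℕ) : ℝ) ^ 2 ≤ q := by exact_mod_cast hq
    have h2 : ((n : ℝ) - (N + 4 * h : ℕ)) / (4 * h) ≤ (((n - N) / (4 * h) : ℕ) : ℝ) := by
      rw [div_le_iff₀ (by positivity)]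
      have h3 := Nat.lt_mul_div_succ (n - N) (show 0 < 4 * h by omega)
      have h4 : n ≤ (n - N) / (4 * h) * (4 * h) + (N + 4 * h) := by
        rw [Nat.mul_succ, mul_comm] at h3
        omega
      have h5 : (n : ℝ) ≤ ((n - N) / (4 * h) : ℕ) * (4 * h) + (N + 4 * h : ℕ) := by
        exact_mod_cast h4
      linarith
    refine le_trans ?_ h1
    calc 5 / (8 * h) * ((n : ℝ) - (N + 4 * h : ℕ)) ^ 2
        = 10 * (h : ℝ) * (((n : ℝ) - (N + 4 * h : ℕ)) / (4 * h)) ^ 2 := by field_simp; ring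
      _ ≤ _ := by gcongr
  calc (p : ℝ) / q ≤ (n * (n + (2 * h : ℕ)) / (2 * h)) /
        (5 / (8 * h) * ((n : ℝ) - (N + 4 * h : ℕ)) ^ 2) := by gcongr
    _ = _ := by field_simp; ring

theorem upperRdet_le_of_card (f : I → I) (x : I) (ε : ℝ) {h : ℕ} (hh : 0 < h) (N : ℕ)
    (hinf : ∀ i j, bowenDist f ⊤ (f^[i] x) (f^[j] x) ≤ ε → i ≡ j [MOD 2 * h])
    (hone : ∀ n, 10 * h * ((n - N) / (4 * h)) ^ 2 ≤ ((Finset.range n ×ˢ Finset.range n).filter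
      (fun ij => bowenDist f 1 (f^[ij.1] x) (f^[ij.2] x) ≤ ε)).card) :
    upperRdet f ⊤ x ε ≤ 4 / 5 := by
  have hlim := tendsto_four_fifths_mul (2 * h : ℕ) (N + 4 * h : ℕ)
  rw [upperRdet, ← hlim.limsup_eq]
  refine limsup_le_limsup ?_ ?_ hlim.isBoundedUnder_le
  · filter_upwards [eventually_gt_atTop (N + 4 * h)] with n hn
    have hn0 : (n : ℝ) ^ 2 ≠ 0 := by
      have : 0 < n := by omega
      positivity
    rw [rdet, corrSum, corrSum, div_div_div_cancel_right₀ hn0]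
    exact div_le_four_fifths_mul hh hn (card_filter_modEq_le (2 * h) n _ fun i j => hinf i j)
      (hone n)
  · exact (isBoundedUnder_of ⟨0, fun n => rdet_nonneg f ⊤ x n ε⟩).isCoboundedUnder_le

theorem dist_le_of_mem_Icc {u v : I} {a b : ℝ} (hu : (u : ℝ) ∈ Set.Icc a b)
    (hv : (v : ℝ) ∈ Set.Icc a b) : dist u v ≤ b - a := by
  rw [Subtype.dist_eq]
  exact Real.dist_le_of_mem_Icc hu hv

theorem IsDyadicTower.frequently_upperRdet_le {f : I → I} {K : ℕ → ℕ → Set I} {x : I}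
    (hK : IsDyadicTower f K) (hf : Continuous f)
    (hω : ∀ L, ∀ y ∈ omegaLimitSet f x, ∃ r, y ∈ K L r)
    (hsep : ∀ y ∈ omegaLimitSet f x, ∀ z ∈ omegaLimitSet f x, ¬ NonSeparable f y z) :
    ∃ᶠ ε in 𝓝[>] (0 : ℝ), upperRdet f ⊤ x ε ≤ 4 / 5 := by
  obtain ⟨lo, hi, hlo, hhi, H⟩ := hK.exists_bounds hf hω
  rw [(nhdsGT_basis (0 : ℝ)).frequently_iff]
  intro η hη
  obtain ⟨L, hL⟩ := hK.exists_forall_dist_lt hsep hη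
  obtain ⟨β, a, b, hβ0, ⟨r₀, hr₀⟩, hβ, hab, hev⟩ := H.exists_threshold L
  have hβη : β < η := by
    have h1 := hL r₀ _ (hlo L r₀).1 _ (hhi L r₀).1
    rw [dist_comm, Subtype.dist_eq, Real.dist_eq] at h1
    exact hr₀.trans_lt ((le_abs_self _).trans_lt h1)
  obtain ⟨ε, hεB, hε⟩ := (hev.and (Ioo_mem_nhdsGT hβη)).exists
  refine ⟨ε, ⟨hβ0.trans_lt hε.1, hε.2⟩, ?_⟩
  obtain ⟨c, hc⟩ := hK.exists_eventually_mem hf hω (L + 2)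
  -- Each of the two iterates is replaced by a limit point at cost `(ε - β) / 2`, which leaves `β`
  -- for the distance of the limit points.
  obtain ⟨N, hN⟩ := eventually_atTop.1
    (hK.exists_dist_lt hc (η := (ε - β) / 2) (by linarith [hε.1]))
  have hh : 0 < 2 ^ (L + 1) := by positivity
  have two : 2 ^ (L + 2) = 2 * 2 ^ (L + 1) := by ring
  have four : 2 ^ (L + 2 + 1) = 4 * 2 ^ (L + 1) := by ring
  obtain ⟨S, hScard, hSlt, hS⟩ := exists_residue_pairs (2 ^ (L + 1)) hh a b
    fun r => ⟨(hab r).1, (hab r).2.1, two ▸ (hab r).2.2.1⟩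
  refine upperRdet_le_of_card f x ε hh N (fun i j hij => two ▸ hεB i j hij) fun n => ?_
  rw [← hScard]
  refine card_mul_sq_le_card_filter _ N c n (by positivity) S hSlt _ fun i j hi' hj' hij => ?_
  rw [bowenDist_one]
  obtain ⟨u, hu, hui⟩ := hN i hi'
  obtain ⟨v, hv, hvj⟩ := hN j hj'
  have huv : dist u v ≤ β := by
    have mem : ∀ {l s t : ℕ} {w : I}, w ∈ omegaLimitSet f x ∩ K l s → s ≡ t [MOD 2 ^ (l + 1)] →
        (w : ℝ) ∈ Set.Icc (lo l t : ℝ) (hi l t) := fun {l s t w} hw hst => by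
      rw [hK.congr l s t hst] at hw
      exact ⟨(hlo l t).2 hw, (hhi l t).2 hw⟩
    have hmod : ∀ {k s : ℕ}, (k + c) % (4 * 2 ^ (L + 1)) ≡ s [MOD 4 * 2 ^ (L + 1)] →
        k + c ≡ s [MOD 2 ^ (L + 2 + 1)] := fun h => by
      rw [four]
      exact (Nat.mod_modEq _ _).symm.trans h
    have hcross : ∀ {r : ℕ} {w z : I},
        (w : ℝ) ∈ Set.Icc (lo (L + 2) (a r) : ℝ) (hi (L + 2) (a r)) →
        (z : ℝ) ∈ Set.Icc (lo (L + 2) (b r) : ℝ) (hi (L + 2) (b r)) → dist w z ≤ β := by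
      intro r w z hw hz
      obtain ⟨-, -, -, h1, h2⟩ := hab r
      have h3 := hz.1.trans hz.2
      have h4 := hw.1.trans hw.2
      exact (dist_le_of_mem_Icc ⟨hw.1, by linarith [hw.2]⟩ ⟨by linarith [hz.1], hz.2⟩).trans h2
    rcases hS _ hij with h | ⟨r, ⟨h1, h2⟩ | ⟨h1, h2⟩⟩
    · have hij2 : i + c ≡ j + c [MOD 2 ^ (L + 1 + 1)] := by
        have hd : 2 * 2 ^ (L + 1) ∣ 4 * 2 ^ (L + 1) := ⟨2, by ring⟩
        rw [show 2 ^ (L + 1 + 1) = 2 * 2 ^ (L + 1) from two]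
        exact (Nat.ModEq.of_dvd hd (Nat.mod_modEq _ _)).symm.trans
          (h.trans (Nat.ModEq.of_dvd hd (Nat.mod_modEq _ _)))
      exact (dist_le_of_mem_Icc (mem ⟨hu.1, hK.antitone (L + 1) _ hu.2⟩ hij2)
        (mem ⟨hv.1, hK.antitone (L + 1) _ hv.2⟩ rfl)).trans (hβ _)
    · exact hcross (mem hu (hmod h1)) (mem hv (hmod h2))
    · rw [dist_comm]
      exact hcross (mem hv (hmod h2)) (mem hu (hmod h1))
  have t := dist_triangle4 (f^[i] x) u v (f^[j] x)
  rw [dist_comm v] at t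
  linarith

theorem proposition4p11 (f : I → I) (hf : Continuous f) (x : I)
    (hsol : IsDyadicSolenoidal f (omegaLimitSet f x))
    (hsep : ∀ y ∈ omegaLimitSet f x, ∀ z ∈ omegaLimitSet f x, ¬ NonSeparable f y z) :
    liminf (fun ε : ℝ => upperRdet f ⊤ x ε) (𝓝[>] (0 : ℝ)) ≤ 4 / 5 := by
  obtain ⟨K, hK, hω⟩ := hsol.exists_tower hf
  refine liminf_le_of_frequently_le (hK.frequently_upperRdet_le hf hω hsep) ?_
  -- The real-valued `liminf` is meaningful only with a lower bound, here `0`.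
  exact isBoundedUnder_of ⟨0, fun ε => upperRdet_nonneg f x ε⟩
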